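/- Let $\mathcal A$ be a premodular category (that is, a ribbon fusion category) over an algebraically closed field $\Bbbk$, with braiding $c$. Let $X_i$, $i\in\mathrm{Irr}(\mathcal A)$, be representatives of the isomorphism classes of simple objects, let $d_i$ be the categorical dimension of $X_i$ (which is nonzero), and let $\mathfrak D=\sum_i d_i^2$. Let $V=K(\mathcal A)\otimes_{\mathbb Z}\Bbbk$ be the Verlinde algebra, with basis $x_i=[X_i]$. It carries the fusion product $$x_i\cdot x_j=\sum_k N_{ij}^k\,x_k,$$ where $N_{ij}^k$ is the multiplicity of $X_k$ in $X_i\otimes X_j$, and the convolution product $$x_i * x_j=\frac{\delta_{ij}}{d_i}\,x_i .$$ Put $s_{ij}=\operatorname{tr}(c_{X_j,X_i^*}\circ c_{X_i^*,X_j})$ and $\overline s_{ij}=\operatorname{tr}(c_{X_i^*,X_j}^{-1}\circ c_{X_j,X_i^*}^{-1})$, where $\operatorname{tr}$ is the categorical trace, and let $s,\overline s:V\to V$ be the linear operators with $s(x_i)=\sum_j s_{ij}x_j$ and $\overline s(x_i)=\sum_j\overline s_{ij}x_j$. Let $J\subset\mathrm{Irr}(\mathcal A)$ be the set of those $i$ for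 which $X_i$ is transparent, i.e. $c_{Y,X_i}\circ c_{X_i,Y}=\mathrm{id}$ for every object $Y$ of $\mathcal A$, and let $\varphi_J=\sum_{i\in J}d_i\,x_i\in V$. Then for all $x,y\in V$ $$s\big((\mathfrak D\varphi_J\cdot x)*y\big)=s\big(x*(\mathfrak D\varphi_J\cdot y)\big)=s(x)\cdot s(y),$$ $$\overline s\big((\mathfrak D\varphi_J\cdot x)*y\big)=\overline s\big(x*(\mathfrak D\varphi_J\cdot y)\big)=\overline s(x)\cdot\overline s(y).$$ -/

import Mathlib

open CategoryTheory MonoidalCategory BraidedCategory Limits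

universe w v u

noncomputable section

namespace Premodular

/-- A ribbon category: a rigid braided category with a twist `θ`, that is, a natural automorphism of
the identity functor with `θ_{X ⊗ Y} = c_{Y,X} ∘ c_{X,Y} ∘ (θ_X ⊗ θ_Y)` and `θ_{X*} = (θ_X)*`.
The dual `X*` is Mathlib's `Xᘁ`, with evaluation `X* ⊗ X ⟶ 𝟙` and coevaluation `𝟙 ⟶ X ⊗ X*`;
in a braided category the existence of these duals gives those on the other side. -/
class RibbonCategory (C : Type u) [Category.{v} C] [MonoidalCategory C] [BraidedCategory C]
    [RightRigidCategory C] where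
  /-- the twist -/
  twist : ∀ X : C, X ≅ X
  twist_naturality : ∀ {X Y : C} (f : X ⟶ Y), f ≫ (twist Y).hom = (twist X).hom ≫ f
  twist_tensor : ∀ X Y : C,
    (twist (X ⊗ Y)).hom =
      ((twist X).hom ⊗ₘ (twist Y).hom) ≫ (β_ X Y).hom ≫ (β_ Y X).hom
  twist_dual : ∀ X : C, (twist (Xᘁ)).hom = ((twist X).hom)ᘁ

/-- The conditions which make a `k`-linear abelian rigid monoidal category (with bilinear tensor
product) a fusion category: the unit is simple, morphism spaces are finite-dimensional, every
object is a finite direct sum of simple objects, and there are finitely many simple objects up to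
isomorphism. -/
class IsFusion (k : Type w) [Field k] (C : Type u) [Category.{v} C] [Abelian C] [Linear k C]
    [MonoidalCategory C] : Prop where
  simple_unit : Simple (𝟙_ C)
  finiteDimensional_hom : ∀ X Y : C, FiniteDimensional k (X ⟶ Y)
  semisimple : ∀ X : C, ∃ (n : ℕ) (S : Fin n → C) (b : Bicone S),
    (∀ a, Simple (S a)) ∧ Nonempty b.IsBilimit ∧ Nonempty (X ≅ b.pt)
  finite_simple : ∃ (n : ℕ) (S : Fin n → C), ∀ Y : C, Simple Y → ∃ a, Nonempty (Y ≅ S a)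

attribute [instance] IsFusion.simple_unit IsFusion.finiteDimensional_hom

/-- A family `X_i`, `i ∈ ι`, with exactly one representative of each isomorphism class of simple
objects; `ι` is thereby identified with the set of isomorphism classes of simple objects. -/
structure SimpleReps (C : Type u) [Category.{v} C] [HasZeroMorphisms C] (ι : Type*) where
  /-- the representatives -/
  obj : ι → C
  simple : ∀ i, Simple (obj i)
  eq_of_iso : ∀ i j, Nonempty (obj i ≅ obj j) → i = j
  exists_iso : ∀ Y : C, Simple Y → ∃ i, Nonempty (Y ≅ obj i)

/-- `X` is transparent: its double braiding with every object is trivial. -/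
def IsTransparent {C : Type u} [Category.{v} C] [MonoidalCategory C] [BraidedCategory C]
    (X : C) : Prop :=
  ∀ Y : C, (β_ X Y).hom ≫ (β_ Y X).hom = 𝟙 (X ⊗ Y)

section Trace

variable (k : Type w) [Field k] [IsAlgClosed k] {C : Type u} [Category.{v} C] [Abelian C]
  [Linear k C] [MonoidalCategory C] [IsFusion k C]

/-- The identification of the endomorphisms of the unit with `k`: the scalar `c` with
`f = c • 𝟙`. -/
def unitScalar (f : 𝟙_ C ⟶ 𝟙_ C) : k :=
  Classical.choose (endomorphism_simple_eq_smul_id k f)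

theorem unitScalar_smul (f : 𝟙_ C ⟶ 𝟙_ C) : unitScalar k f • 𝟙 (𝟙_ C) = f :=
  Classical.choose_spec (endomorphism_simple_eq_smul_id k f)

variable [BraidedCategory C] [RightRigidCategory C] [RibbonCategory C]

/-- The quantum trace of an endomorphism in a ribbon category,
`𝟙 ⟶ X ⊗ X* ⟶ X ⊗ X* ⟶ X* ⊗ X ⟶ 𝟙`: coevaluation, `θ_X ∘ f` on the first factor, braiding,
evaluation. -/
def trace {X : C} (f : X ⟶ X) : k :=
  unitScalar k (η_ X (Xᘁ) ≫ (f ≫ (RibbonCategory.twist X).hom) ▷ (Xᘁ) ≫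
    (β_ X (Xᘁ)).hom ≫ ε_ X (Xᘁ))

/-- The categorical dimension. -/
def dim (X : C) : k := trace k (𝟙 X)

end Trace

section Verlinde

variable (k : Type w) [Field k] [IsAlgClosed k] {C : Type u} [Category.{v} C] [Abelian C]
  [Linear k C] [MonoidalCategory C] [IsFusion k C]
  [BraidedCategory C] [RightRigidCategory C] [RibbonCategory C]
  {ι : Type*} [Fintype ι] (X : SimpleReps C ι)

/-- The global dimension `𝔇 = ∑ d_i²`. -/
def globalDim : k := ∑ i, dim k (X.obj i) ^ 2

/-- `s_{ij}`, the trace of `c_{j,i*} ∘ c_{i*,j}` on `X_i* ⊗ X_j`. -/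
def sMatrix (i j : ι) : k :=
  trace k ((β_ ((X.obj i)ᘁ) (X.obj j)).hom ≫ (β_ (X.obj j) ((X.obj i)ᘁ)).hom)

/-- `s̄_{ij}`, the trace of `c_{i*,j}⁻¹ ∘ c_{j,i*}⁻¹` on `X_i* ⊗ X_j`. -/
def sBarMatrix (i j : ι) : k :=
  trace k ((β_ (X.obj j) ((X.obj i)ᘁ)).inv ≫ (β_ ((X.obj i)ᘁ) (X.obj j)).inv)

/-- `N_{ij}^l`, the multiplicity of the simple object `X_l` in `X_i ⊗ X_j`. -/
def fusionCoeff (i j l : ι) : ℕ := Module.finrank k (X.obj l ⟶ X.obj i ⊗ X.obj j)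

/-- The underlying vector space of the Verlinde algebra (the Grothendieck ring with coefficients
extended to `k`): the free `k`-module on the classes `x_i` of the simple objects. -/
abbrev Verlinde (k : Type*) [Field k] (ι : Type*) : Type _ := ι →₀ k

/-- The basis vector `x_i` of the Verlinde algebra. -/
def basisVec (i : ι) : Verlinde k ι := Finsupp.single i 1

/-- The fusion product, bilinear with `x_i · x_j = ∑_l N_{ij}^l x_l`. -/
def fusion : Verlinde k ι →ₗ[k] Verlinde k ι →ₗ[k] Verlinde k ι :=
  Finsupp.linearCombination k fun i => Finsupp.linearCombination k fun j =>
    ∑ l, (fusionCoeff k X i j l : k) • basisVec k l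

open Classical in
/-- The convolution product, bilinear with `x_i * x_j = (δ_{ij} / d_i) x_i`. (Simple objects
have nonzero dimension.) -/
def conv : Verlinde k ι →ₗ[k] Verlinde k ι →ₗ[k] Verlinde k ι :=
  Finsupp.linearCombination k fun i => Finsupp.linearCombination k fun j =>
    ((if i = j then 1 else 0) / dim k (X.obj i)) • basisVec k i

/-- The linear operator with `s(x_i) = ∑_j s_{ij} x_j`. -/
def sMap : Verlinde k ι →ₗ[k] Verlinde k ι :=
  Finsupp.linearCombination k fun i => ∑ j, sMatrix k X i j • basisVec k j

/-- The linear operator with `s̄(x_i) = ∑_j s̄_{ij} x_j`. -/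
def sBarMap : Verlinde k ι →ₗ[k] Verlinde k ι :=
  Finsupp.linearCombination k fun i => ∑ j, sBarMatrix k X i j • basisVec k j

open Classical in
/-- `φ_J = ∑_{i ∈ J} d_i x_i`, where `J` is the set of transparent simple objects. -/
def phiJ : Verlinde k ι :=
  ∑ i with IsTransparent (X.obj i), dim k (X.obj i) • basisVec k i

end Verlinde

end Premodular

end

/-!
A loop coloured by `∑ d_l X_l` around `Y` satisfies the handle slide: decomposing `M ⊗ X_l` into
simple objects and rotating the summands, any strand `M` may be passed through it. Hence `Y` so
encircled braids trivially with everything. For simple `Y` the loop acts by a scalar, which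
therefore vanishes unless `Y` is transparent, and with the Hopf link invariant `L` this reads
`∑_l d_l L(Y, X_l) = 𝔇 d_Y` or `0` according to whether `Y` is transparent.

For simple `X` one has `L(X, Y) L(X, Z) = d_X L(X, Y ⊗ Z)`. Summing over `X = X_l` gives
`∑_l L(Y, X_l) L(Z, X_l) = 𝔇 ∑_{c ∈ J} d_c [Y ⊗ Z : X_c]`, so `𝔇 φ_J · y` has the coordinates
`∑_l L(X_a, X_l) s(y)_l`, and a second use of the multiplicativity turns `s(x * (𝔇 φ_J · y))` into
`s(x) · s(y)`. The operator `s̄` is `s` for the reversed braiding with the inverse twist, a ribbon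
structure with the same trace.
-/

noncomputable section

namespace Premodular

section DualMorphism

variable {C : Type u} [Category.{v} C] [MonoidalCategory C]

/-- `t : D' ⟶ D` is the dual (mate) of `f : X ⟶ X'` with respect to arbitrary duals `D` of `X` and
`D'` of `X'`. A predicate, because the duals which occur are not always the chosen `Xᘁ`. -/
def IsDualHom {X D X' D' : C} [ExactPairing X D] [ExactPairing X' D'] (f : X ⟶ X') (t : D' ⟶ D) :
    Prop :=
  t ▷ X ≫ ε_ X D = D' ◁ f ≫ ε_ X' D'

variable {X D X' D' : C} [ExactPairing X D] [ExactPairing X' D']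

theorem exists_isDualHom (D D' : C) [ExactPairing X D] [ExactPairing X' D'] (f : X ⟶ X') :
    ∃ t : D' ⟶ D, IsDualHom f t :=
  let _ : HasRightDual X := ⟨D⟩
  let _ : HasRightDual X' := ⟨D'⟩
  ⟨fᘁ, rightAdjointMate_comp_evaluation f⟩

theorem IsDualHom.comp {X'' D'' : C} [ExactPairing X'' D''] {f : X ⟶ X'} {t : D' ⟶ D}
    (hf : IsDualHom f t) {g : X' ⟶ X''} {s : D'' ⟶ D'} (hg : IsDualHom g s) :
    IsDualHom (f ≫ g) (s ≫ t) := by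
  rw [IsDualHom] at hf hg ⊢
  rw [comp_whiskerRight, Category.assoc, hf, ← whisker_exchange_assoc, hg,
    MonoidalCategory.whiskerLeft_comp, Category.assoc]

theorem IsDualHom.unique {f : X ⟶ X'} {s t : D' ⟶ D} (hs : IsDualHom f s) (ht : IsDualHom f t) :
    s = t := by
  rw [← cancel_mono (λ_ D).inv, ← (tensorRightHomEquiv D' X D (𝟙_ C)).symm.injective.eq_iff]
  have bend (r : D' ⟶ D) :
      (tensorRightHomEquiv D' X D (𝟙_ C)).symm (r ≫ (λ_ D).inv) = r ▷ X ≫ ε_ X D := by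
    simp only [tensorRightHomEquiv, Equiv.coe_fn_symm_mk]
    monoidal
  rw [bend, bend, hs, ht]

theorem IsDualHom.coevaluation_comp {f : X ⟶ X'} {t : D' ⟶ D} (h : IsDualHom f t) :
    η_ X' D' ≫ X' ◁ t = η_ X D ≫ f ▷ D := by
  let _ : HasRightDual X := ⟨D⟩
  let _ : HasRightDual X' := ⟨D'⟩
  rw [h.unique (t := fᘁ) (rightAdjointMate_comp_evaluation f)]
  exact coevaluation_comp_rightAdjointMate f

end DualMorphism

section Braided

variable {C : Type u} [Category.{v} C] [MonoidalCategory C] [BraidedCategory C]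

/-- The double braiding `c_{L,Y} ∘ c_{Y,L}` of `Y` with `L`. -/
def doubleBraiding (Y L : C) : Y ⊗ L ⟶ Y ⊗ L := (β_ Y L).hom ≫ (β_ L Y).hom

theorem doubleBraiding_naturality_right (Y : C) {L L' : C} (g : L ⟶ L') :
    Y ◁ g ≫ doubleBraiding Y L' = doubleBraiding Y L ≫ Y ◁ g := by
  simp [doubleBraiding]

theorem doubleBraiding_tensor_right (Y M L : C) :
    (α_ Y M L).hom ≫ doubleBraiding Y (M ⊗ L) ≫ (α_ Y M L).inv =
      (β_ Y M).hom ▷ L ≫ ((α_ M Y L).hom ≫ M ◁ doubleBraiding Y L ≫ (α_ M Y L).inv) ≫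
        (β_ M Y).hom ▷ L := by
  simp [doubleBraiding, braiding_tensor_right_hom, braiding_tensor_left_hom]

theorem braiding_right_comp_whiskerRight (L : C) {A : C} (e : A ⟶ 𝟙_ C) :
    (β_ L A).hom ≫ e ▷ L = L ◁ e ⊗≫ 𝟙 _ := by
  rw [← braiding_naturality_right, braiding_tensorUnit_right]
  monoidal

theorem braiding_left_comp_whiskerLeft (L : C) {A : C} (e : A ⟶ 𝟙_ C) :
    (β_ A L).hom ≫ L ◁ e = e ▷ L ⊗≫ 𝟙 _ := by
  rw [← braiding_naturality_left, braiding_tensorUnit_left]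
  monoidal

theorem whiskerLeft_braiding_comp_whiskerRight (L A B : C) (e : A ⊗ B ⟶ 𝟙_ C) :
    A ◁ (β_ L B).hom ⊗≫ e ▷ L = 𝟙 _ ⊗≫ (β_ L A).inv ▷ B ⊗≫ L ◁ e ⊗≫ 𝟙 _ := by
  calc
    _ = 𝟙 _ ⊗≫ ((β_ L A).inv ≫ (β_ L A).hom) ▷ B ⊗≫ A ◁ (β_ L B).hom ⊗≫ e ▷ L := by
      rw [Iso.inv_hom_id]; monoidal
    _ = 𝟙 _ ⊗≫ (β_ L A).inv ▷ B ⊗≫ ((β_ L (A ⊗ B)).hom ≫ e ▷ L) := by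
      rw [braiding_tensor_right_hom]; monoidal
    _ = _ := by rw [braiding_right_comp_whiskerRight]

theorem braiding_whiskerRight_comp_whiskerLeft (L A B : C) (e : A ⊗ B ⟶ 𝟙_ C) :
    (β_ A L).hom ▷ B ⊗≫ L ◁ e = 𝟙 _ ⊗≫ A ◁ (β_ B L).inv ⊗≫ e ▷ L ⊗≫ 𝟙 _ := by
  calc
    _ = 𝟙 _ ⊗≫ A ◁ ((β_ B L).inv ≫ (β_ B L).hom) ⊗≫ (β_ A L).hom ▷ B ⊗≫ L ◁ e := by
      rw [Iso.inv_hom_id]; monoidal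
    _ = 𝟙 _ ⊗≫ A ◁ (β_ B L).inv ⊗≫ ((β_ (A ⊗ B) L).hom ≫ L ◁ e) := by
      rw [braiding_tensor_left_hom]; monoidal
    _ = _ := by rw [braiding_left_comp_whiskerLeft]

theorem isDualHom_braiding (X Y X' Y' : C) [ExactPairing X X'] [ExactPairing Y Y'] :
    IsDualHom (β_ X Y).hom (β_ X' Y').hom := by
  rw [IsDualHom, ExactPairing.tensor_evaluation, ExactPairing.tensor_evaluation]
  have hX := braiding_whiskerRight_comp_whiskerLeft Y' X' X (ε_ X X')
  have hY := whiskerLeft_braiding_comp_whiskerRight X Y' Y (ε_ Y Y')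
  calc
    _ = 𝟙 _ ⊗≫ ((β_ X' Y').hom ▷ X ⊗≫ Y' ◁ ε_ X X') ▷ Y ⊗≫ ε_ Y Y' := by monoidal
    _ = 𝟙 _ ⊗≫ X' ◁ (β_ X Y').inv ▷ Y ⊗≫ (ε_ X X' ▷ (Y' ⊗ Y) ≫ 𝟙_ C ◁ ε_ Y Y') ⊗≫ 𝟙 _ := by
      rw [hX]; monoidal
    _ = 𝟙 _ ⊗≫ X' ◁ (Y' ◁ (β_ X Y).hom ⊗≫ ε_ Y Y' ▷ X) ⊗≫ ε_ X X' := by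
      rw [hY, ← whisker_exchange]; monoidal
    _ = _ := by monoidal

theorem isDualHom_doubleBraiding (X Y X' Y' : C) [ExactPairing X X'] [ExactPairing Y Y'] :
    IsDualHom (doubleBraiding X Y) (doubleBraiding Y' X') :=
  (isDualHom_braiding X Y X' Y').comp (isDualHom_braiding Y X Y' X')

theorem braiding_comp_evaluation_tensor (Y L Y' L' : C) [ExactPairing Y Y'] [ExactPairing L L'] :
    (β_ (Y ⊗ L) (L' ⊗ Y')).hom ≫ ε_ (Y ⊗ L) (L' ⊗ Y') =
      (β_ L Y).inv ▷ (L' ⊗ Y') ⊗≫ L ◁ (β_ Y L').hom ▷ Y' ⊗≫ ((β_ L L').hom ≫ ε_ L L') ▷ (Y ⊗ Y') ⊗≫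
        ((β_ Y Y').hom ≫ ε_ Y Y') := by
  have hY := whiskerLeft_braiding_comp_whiskerRight L Y Y' ((β_ Y Y').hom ≫ ε_ Y Y')
  calc
    _ = 𝟙 _ ⊗≫ (β_ (Y ⊗ L) L').hom ▷ Y' ⊗≫
          L' ◁ (Y ◁ (β_ L Y').hom ⊗≫ ((β_ Y Y').hom ≫ ε_ Y Y') ▷ L) ⊗≫ ε_ L L' := by
      rw [ExactPairing.tensor_evaluation, braiding_tensor_right_hom,
        braiding_tensor_left_hom Y L Y']
      monoidal
    _ = 𝟙 _ ⊗≫ ((β_ (Y ⊗ L) L').hom ≫ L' ◁ (β_ L Y).inv) ▷ Y' ⊗≫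
          L' ◁ L ◁ ((β_ Y Y').hom ≫ ε_ Y Y') ⊗≫ ε_ L L' := by
      rw [hY]; monoidal
    _ = (β_ L Y).inv ▷ (L' ⊗ Y') ⊗≫ L ◁ (β_ Y L').hom ▷ Y' ⊗≫ (β_ L L').hom ▷ (Y ⊗ Y') ⊗≫
          ((L' ⊗ L) ◁ ((β_ Y Y').hom ≫ ε_ Y Y') ≫ ε_ L L' ▷ 𝟙_ C) ⊗≫ 𝟙 _ := by
      rw [← braiding_naturality_left, braiding_tensor_left_hom]; monoidal
    _ = _ := by rw [whisker_exchange]; monoidal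

theorem doubleBraiding_comp_braiding_comp_evaluation (Y L Y' L' : C) [ExactPairing Y Y']
    [ExactPairing L L'] :
    doubleBraiding Y L ▷ (L' ⊗ Y') ≫ (β_ (Y ⊗ L) (L' ⊗ Y')).hom ≫ ε_ (Y ⊗ L) (L' ⊗ Y') =
      𝟙 _ ⊗≫ Y ◁ ((β_ L L').hom ≫ ε_ L L') ▷ Y' ⊗≫ ((β_ Y Y').hom ≫ ε_ Y Y') := by
  have hL := whiskerLeft_braiding_comp_whiskerRight Y L L' ((β_ L L').hom ≫ ε_ L L')
  calc
    _ = ((β_ Y L).hom ≫ (β_ L Y).hom ≫ (β_ L Y).inv) ▷ (L' ⊗ Y') ⊗≫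
          (L ◁ (β_ Y L').hom ⊗≫ ((β_ L L').hom ≫ ε_ L L') ▷ Y) ▷ Y' ⊗≫
          ((β_ Y Y').hom ≫ ε_ Y Y') := by
      rw [braiding_comp_evaluation_tensor, doubleBraiding]; monoidal
    _ = ((β_ Y L).hom ≫ (β_ Y L).inv) ▷ (L' ⊗ Y') ⊗≫ Y ◁ ((β_ L L').hom ≫ ε_ L L') ▷ Y' ⊗≫
          ((β_ Y Y').hom ≫ ε_ Y Y') := by
      rw [hL, Iso.hom_inv_id, Category.comp_id]; monoidal
    _ = _ := by rw [Iso.hom_inv_id]; monoidal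

end Braided

section Ribbon

variable {C : Type u} [Category.{v} C] [MonoidalCategory C] [BraidedCategory C]
  [RightRigidCategory C] [RibbonCategory C]

theorem isDualHom_twist (X D : C) [ExactPairing X D] :
    IsDualHom (RibbonCategory.twist X).hom (RibbonCategory.twist D).hom := by
  obtain ⟨t, ht⟩ := exists_isDualHom (Xᘁ) D (𝟙 X)
  have hX : IsDualHom (RibbonCategory.twist X).hom (RibbonCategory.twist (Xᘁ)).hom := by
    rw [RibbonCategory.twist_dual]
    exact rightAdjointMate_comp_evaluation _
  rw [IsDualHom, whiskerLeft_id, Category.id_comp] at ht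
  rw [IsDualHom] at hX ⊢
  rw [← ht, ← comp_whiskerRight_assoc, ← RibbonCategory.twist_naturality, comp_whiskerRight_assoc,
    hX, whisker_exchange_assoc]

/-- The evaluation `X ⊗ D ⟶ 𝟙` which makes the dual `D` a dual of `X` on the other side. -/
def cap (X D : C) [ExactPairing X D] : X ⊗ D ⟶ 𝟙_ C :=
  (RibbonCategory.twist X).hom ▷ D ≫ (β_ X D).hom ≫ ε_ X D

/-- The trace of `f`, as an endomorphism of the unit, computed with an arbitrary dual of `X`. -/
def unitTrace (X D : C) [ExactPairing X D] (f : X ⟶ X) : 𝟙_ C ⟶ 𝟙_ C :=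
  η_ X D ≫ f ▷ D ≫ cap X D

/-- The partial trace over the second tensor factor. -/
def partialTrace (L D : C) [ExactPairing L D] {Y Y' : C} (g : Y ⊗ L ⟶ Y' ⊗ L) : Y ⟶ Y' :=
  𝟙 _ ⊗≫ Y ◁ η_ L D ⊗≫ g ▷ D ⊗≫ Y' ◁ cap L D ⊗≫ 𝟙 _

theorem partialTrace_whiskerRight (L D : C) [ExactPairing L D] {Y Y' Z Z' : C} (a : Y ⟶ Y')
    (g : Y' ⊗ L ⟶ Z ⊗ L) (b : Z ⟶ Z') :
    partialTrace L D (a ▷ L ≫ g ≫ b ▷ L) = a ≫ partialTrace L D g ≫ b := by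
  calc
    _ = 𝟙 _ ⊗≫ (Y ◁ η_ L D ≫ a ▷ (L ⊗ D)) ⊗≫ g ▷ D ⊗≫ (b ▷ (L ⊗ D) ≫ Z' ◁ cap L D) ⊗≫ 𝟙 _ := by
      rw [partialTrace]; monoidal
    _ = 𝟙 _ ⊗≫ (a ▷ 𝟙_ C ≫ Y' ◁ η_ L D) ⊗≫ g ▷ D ⊗≫ (Z ◁ cap L D ≫ b ▷ 𝟙_ C) ⊗≫ 𝟙 _ := by
      rw [whisker_exchange a, whisker_exchange b]
    _ = _ := by rw [partialTrace]; monoidal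

theorem partialTrace_whiskerRight_comp (L D : C) [ExactPairing L D] {Y Y' Z : C} (a : Y ⟶ Y')
    (g : Y' ⊗ L ⟶ Z ⊗ L) : partialTrace L D (a ▷ L ≫ g) = a ≫ partialTrace L D g := by
  simpa using partialTrace_whiskerRight L D a g (𝟙 Z)

theorem partialTrace_comp_whiskerRight (L D : C) [ExactPairing L D] {Y Y' Z : C}
    (g : Y ⊗ L ⟶ Y' ⊗ L) (b : Y' ⟶ Z) :
    partialTrace L D (g ≫ b ▷ L) = partialTrace L D g ≫ b := by
  simpa using partialTrace_whiskerRight L D (𝟙 Y) g b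

theorem partialTrace_whiskerLeft (L D : C) [ExactPairing L D] (M : C) {Y Y' : C}
    (g : Y ⊗ L ⟶ Y' ⊗ L) :
    partialTrace L D ((α_ M Y L).hom ≫ M ◁ g ≫ (α_ M Y' L).inv) = M ◁ partialTrace L D g := by
  rw [partialTrace, partialTrace]; monoidal

theorem partialTrace_doubleBraiding_tensor (Y M L D : C) [ExactPairing L D] :
    partialTrace L D ((α_ Y M L).hom ≫ doubleBraiding Y (M ⊗ L) ≫ (α_ Y M L).inv) =
      partialTrace L D (doubleBraiding Y L) ▷ M ≫ doubleBraiding Y M := by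
  rw [doubleBraiding_tensor_right, partialTrace_whiskerRight, partialTrace_whiskerLeft,
    doubleBraiding, doubleBraiding, braiding_naturality_left_assoc]

theorem IsDualHom.whiskerLeft_comp_cap {X D X' D' : C} [ExactPairing X D] [ExactPairing X' D']
    {f : X ⟶ X'} {t : D' ⟶ D} (h : IsDualHom f t) : X ◁ t ≫ cap X D = f ▷ D' ≫ cap X' D' := by
  rw [IsDualHom] at h
  rw [cap, cap, whisker_exchange_assoc, braiding_naturality_right_assoc, h,
    ← comp_whiskerRight_assoc, RibbonCategory.twist_naturality, comp_whiskerRight_assoc]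
  simp only [braiding_naturality_left_assoc]

theorem unitTrace_comp_comm (X X' D D' : C) [ExactPairing X D] [ExactPairing X' D']
    (f : X ⟶ X') (g : X' ⟶ X) : unitTrace X D (f ≫ g) = unitTrace X' D' (g ≫ f) := by
  obtain ⟨t, ht⟩ := exists_isDualHom D D' f
  calc
    _ = (η_ X D ≫ f ▷ D) ≫ g ▷ D ≫ cap X D := by
      simp only [unitTrace, comp_whiskerRight, Category.assoc]
    _ = η_ X' D' ≫ g ▷ D' ≫ X ◁ t ≫ cap X D := by
      rw [← ht.coevaluation_comp, Category.assoc, whisker_exchange_assoc]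
    _ = _ := by
      rw [ht.whiskerLeft_comp_cap, unitTrace, comp_whiskerRight, Category.assoc]

theorem cap_eq_whiskerLeft_twist_comp (X D : C) [ExactPairing X D] :
    cap X D = X ◁ (RibbonCategory.twist D).hom ≫ (β_ X D).hom ≫ ε_ X D := by
  have h := isDualHom_twist X D
  rw [IsDualHom] at h
  rw [cap, braiding_naturality_left_assoc, ← h, braiding_naturality_right_assoc]

theorem unitTrace_dual {X D D' : C} [ExactPairing X D] [ExactPairing D D'] (t : D ⟶ D) :
    unitTrace D D' t = η_ X D ≫ X ◁ t ≫ cap X D := by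
  let _ : ExactPairing D X := exactPairing_swap X D
  have hη : η_ D X = η_ X D ≫ (β_ D X).inv := rfl
  have hε : ε_ D X = (β_ X D).hom ≫ ε_ X D := rfl
  calc
    _ = unitTrace D X t := by simpa using unitTrace_comp_comm D D D' X t (𝟙 D)
    _ = _ := by
      rw [unitTrace, cap, hη, hε, cap_eq_whiskerLeft_twist_comp]
      simp

theorem unitTrace_eq_of_isDualHom {X D D' : C} [ExactPairing X D] [ExactPairing D D'] {f : X ⟶ X}
    {t : D ⟶ D} (h : IsDualHom f t) : unitTrace D D' t = unitTrace X D f := by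
  rw [unitTrace_dual (X := X), ← Category.assoc, h.coevaluation_comp, unitTrace, Category.assoc]

theorem cap_tensor (Y L Y' L' : C) [ExactPairing Y Y'] [ExactPairing L L'] :
    cap (Y ⊗ L) (L' ⊗ Y') = 𝟙 _ ⊗≫ Y ◁ cap L L' ▷ Y' ⊗≫ cap Y Y' := by
  have h := doubleBraiding_comp_braiding_comp_evaluation Y L Y' L'
  calc
    _ = ((RibbonCategory.twist Y).hom ⊗ₘ (RibbonCategory.twist L).hom) ▷ (L' ⊗ Y') ≫
          doubleBraiding Y L ▷ (L' ⊗ Y') ≫ (β_ (Y ⊗ L) (L' ⊗ Y')).hom ≫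
            ε_ (Y ⊗ L) (L' ⊗ Y') := by
      simp only [cap, RibbonCategory.twist_tensor, doubleBraiding, comp_whiskerRight,
        Category.assoc]
    _ = 𝟙 _ ⊗≫ Y ◁ (RibbonCategory.twist L).hom ▷ (L' ⊗ Y') ⊗≫
          ((RibbonCategory.twist Y).hom ▷ (L ⊗ L') ≫ Y ◁ ((β_ L L').hom ≫ ε_ L L')) ▷ Y' ⊗≫
            ((β_ Y Y').hom ≫ ε_ Y Y') := by
      rw [h, tensorHom_def']; monoidal
    _ = _ := by
      rw [← whisker_exchange, cap, cap]; monoidal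

theorem unitTrace_tensor (Y L Y' L' : C) [ExactPairing Y Y'] [ExactPairing L L']
    (f : Y ⊗ L ⟶ Y ⊗ L) :
    unitTrace (Y ⊗ L) (L' ⊗ Y') f = unitTrace Y Y' (partialTrace L L' f) := by
  rw [unitTrace, cap_tensor, ExactPairing.tensor_coevaluation, unitTrace, partialTrace]
  monoidal

theorem exists_eq_whiskerRight_comp_cap {X D : C} [ExactPairing X D] (r : X ⊗ D ⟶ 𝟙_ C) :
    ∃ g : X ⟶ X, r = g ▷ D ≫ cap X D := by
  let g := tensorLeftHomEquiv X X D (𝟙_ C) ((β_ X D).inv ≫ r) ≫ (ρ_ X).hom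
  have hg : D ◁ g ≫ ε_ X D = (β_ X D).inv ≫ r := by
    rw [← (tensorLeftHomEquiv X X D (𝟙_ C)).symm_apply_apply ((β_ X D).inv ≫ r)]
    simp only [tensorLeftHomEquiv, Equiv.coe_fn_symm_mk, g]
    monoidal
  refine ⟨g ≫ (RibbonCategory.twist X).inv, ?_⟩
  rw [cap, ← comp_whiskerRight_assoc, Category.assoc, Iso.inv_hom_id, Category.comp_id,
    braiding_naturality_left_assoc, hg, Iso.hom_inv_id_assoc]

/-- Bending a morphism out of `D ⊗ J`, with `D` dual to `M`, to a morphism into `M ⊗ L`. -/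
def bendUp (M D : C) [ExactPairing M D] {J L : C} (p : D ⊗ J ⟶ L) : J ⟶ M ⊗ L :=
  tensorLeftHomEquiv J M D L p

/-- Bending a morphism into `D ⊗ J`, with `D` dual to `M`, to a morphism out of `M ⊗ L`. -/
def bendDown (M D : C) [ExactPairing M D] {J L : C} (q : L ⟶ D ⊗ J) : M ⊗ L ⟶ J :=
  M ◁ q ≫ (α_ _ _ _).inv ≫ cap M D ▷ J ≫ (λ_ _).hom

theorem bendUp_comp_bendDown (M D J L : C) [ExactPairing M D] (p : D ⊗ J ⟶ L) (q : L ⟶ D ⊗ J)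
    {A B : C} (g : B ⊗ M ⟶ A ⊗ M) :
    B ◁ bendUp M D p ≫ (α_ B M L).inv ≫ g ▷ L ≫ (α_ A M L).hom ≫ A ◁ bendDown M D q =
      𝟙 _ ⊗≫ B ◁ η_ M D ▷ J ⊗≫ g ▷ (D ⊗ J) ⊗≫ (A ⊗ M) ◁ (p ≫ q) ⊗≫ A ◁ cap M D ▷ J ⊗≫ 𝟙 _ := by
  calc
    _ = 𝟙 _ ⊗≫ B ◁ η_ M D ▷ J ⊗≫ ((B ⊗ M) ◁ p ≫ g ▷ L) ⊗≫ (A ⊗ M) ◁ q ⊗≫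
          A ◁ cap M D ▷ J ⊗≫ 𝟙 _ := by
      simp only [bendUp, bendDown, tensorLeftHomEquiv, Equiv.coe_fn_mk]; monoidal
    _ = _ := by rw [whisker_exchange]; monoidal

theorem partialTrace_whiskerRight_eq (M D J : C) [ExactPairing M D] {A B : C}
    (g : B ⊗ M ⟶ A ⊗ M) :
    partialTrace M D g ▷ J =
      𝟙 _ ⊗≫ B ◁ η_ M D ▷ J ⊗≫ g ▷ (D ⊗ J) ⊗≫ (A ⊗ M) ◁ 𝟙 (D ⊗ J) ⊗≫
        A ◁ cap M D ▷ J ⊗≫ 𝟙 _ := by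
  rw [partialTrace]; monoidal

/-- Both sides are the same closed diagram, with the strand `M` rotated to the other side. -/
theorem unitTrace_bendUp_comp_bendDown (M D J J' L L' : C) [ExactPairing M D] [ExactPairing J J']
    [ExactPairing L L'] (p : D ⊗ J ⟶ L) (q : L ⟶ D ⊗ J) :
    unitTrace J J' (bendUp M D p ≫ bendDown M D q) = unitTrace L L' (q ≫ p) := by
  calc
    _ = 𝟙 _ ⊗≫ (𝟙_ C ◁ η_ J J' ≫ η_ M D ▷ (J ⊗ J')) ⊗≫ M ◁ (p ≫ q) ▷ J' ⊗≫
          (cap M D ▷ (J ⊗ J') ≫ 𝟙_ C ◁ cap J J') ⊗≫ 𝟙 _ := by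
      simp only [unitTrace, bendUp, bendDown, tensorLeftHomEquiv, Equiv.coe_fn_mk]; monoidal
    _ = 𝟙 _ ⊗≫ (η_ M D ▷ 𝟙_ C ≫ (M ⊗ D) ◁ η_ J J') ⊗≫ M ◁ (p ≫ q) ▷ J' ⊗≫
          ((M ⊗ D) ◁ cap J J' ≫ cap M D ▷ 𝟙_ C) ⊗≫ 𝟙 _ := by
      rw [whisker_exchange (η_ M D), whisker_exchange (cap M D)]
    _ = η_ M D ≫ M ◁ partialTrace J J' (p ≫ q) ≫ cap M D := by
      rw [partialTrace]; monoidal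
    _ = unitTrace (D ⊗ J) (J' ⊗ Dᘁ) (p ≫ q) := by
      rw [unitTrace_tensor, unitTrace_dual (X := M)]
    _ = _ := unitTrace_comp_comm _ _ _ _ p q

end Ribbon

section Adjunction

variable {C : Type u} [Category.{v} C] [Preadditive C] [MonoidalCategory C] [MonoidalPreadditive C]

theorem coevaluation_ne_zero (S D : C) [ExactPairing S D] (hS : 𝟙 S ≠ 0) :
    η_ S D ≠ 0 := by
  intro h
  have zigzag := ExactPairing.evaluation_coevaluation S D
  rw [h, MonoidalPreadditive.zero_whiskerRight, zero_comp] at zigzag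
  apply hS
  rw [← cancel_epi (λ_ S).hom, ← cancel_mono (ρ_ S).inv]
  simpa using zigzag.symm

variable (k : Type w) [Field k] [Linear k C] [MonoidalLinear k C]

theorem finrank_tensor_left_hom (A B B' Z : C)
    [ExactPairing B B'] :
    Module.finrank k (B' ⊗ A ⟶ Z) = Module.finrank k (A ⟶ B ⊗ Z) :=
  LinearEquiv.finrank_eq
    { tensorLeftHomEquiv A B B' Z with
      map_add' := fun f g => by simp [tensorLeftHomEquiv]
      map_smul' := fun c f => by simp [tensorLeftHomEquiv] }

theorem finrank_tensor_right_hom (A B B' Z : C)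
    [ExactPairing B B'] :
    Module.finrank k (A ⊗ B ⟶ Z) = Module.finrank k (A ⟶ Z ⊗ B') :=
  LinearEquiv.finrank_eq
    { tensorRightHomEquiv A B B' Z with
      map_add' := fun f g => by simp [tensorRightHomEquiv]
      map_smul' := fun c f => by simp [tensorRightHomEquiv] }

end Adjunction

section Semisimple

variable {C : Type u} [Category.{v} C] [Abelian C] [MonoidalCategory C]

theorem exists_sum_comp_eq_id (k : Type w) [Field k] [Linear k C] [IsFusion k C] (Z : C) :
    ∃ (n : ℕ) (S : Fin n → C) (p : ∀ a, Z ⟶ S a) (i : ∀ a, S a ⟶ Z),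
      (∀ a, Simple (S a)) ∧ ∑ a, p a ≫ i a = 𝟙 Z := by
  obtain ⟨n, S, b, hS, ⟨hb⟩, ⟨e⟩⟩ := IsFusion.semisimple k Z
  refine ⟨n, S, fun a => e.hom ≫ b.π a, fun a => b.ι a ≫ e.inv, hS, ?_⟩
  calc
    _ = e.hom ≫ (∑ a, b.π a ≫ b.ι a) ≫ e.inv := by
      simp only [Preadditive.comp_sum, Preadditive.sum_comp, Category.assoc]
    _ = _ := by rw [IsBilimit.total hb, Category.id_comp, e.hom_inv_id]

theorem hom_ext_of_simple (k : Type w) [Field k] [Linear k C] [IsFusion k C] {Z W : C} {f g : Z ⟶ W}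
    (h : ∀ (S : C) [Simple S] (i : S ⟶ Z), i ≫ f = i ≫ g) : f = g := by
  obtain ⟨n, S, p, i, hS, hid⟩ := exists_sum_comp_eq_id k Z
  rw [← Category.id_comp f, ← Category.id_comp g, ← hid]
  simp only [Preadditive.sum_comp, Category.assoc, h]

theorem exists_retraction (k : Type w) [Field k] [Linear k C] [IsFusion k C] {S Z : C} [Simple S]
    {f : S ⟶ Z} (hf : f ≠ 0) : ∃ r : Z ⟶ S, f ≫ r = 𝟙 S := by
  obtain ⟨n, S', p, i, hS', hid⟩ := exists_sum_comp_eq_id k Z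
  obtain ⟨a, ha⟩ : ∃ a, f ≫ p a ≠ 0 := by
    by_contra! h
    apply hf
    rw [← Category.comp_id f, ← hid, Preadditive.comp_sum]
    simp only [reassoc_of% h, zero_comp, Finset.sum_const_zero]
  have := isIso_of_hom_simple ha
  exact ⟨p a ≫ inv (f ≫ p a), by rw [← Category.assoc, IsIso.hom_inv_id]⟩

end Semisimple

section Trace

variable (k : Type w) [Field k] [IsAlgClosed k] {C : Type u} [Category.{v} C] [Abelian C]
  [Linear k C] [MonoidalCategory C] [IsFusion k C]
  [BraidedCategory C] [RightRigidCategory C] [RibbonCategory C]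

theorem trace_smul_id {X : C} (D : C) [ExactPairing X D] (f : X ⟶ X) :
    trace k f • 𝟙 (𝟙_ C) = unitTrace X D f := by
  have h := unitTrace_comp_comm X X (Xᘁ) D f (𝟙 X)
  rw [Category.comp_id, Category.id_comp] at h
  rw [trace, unitScalar_smul, ← h, unitTrace, cap, comp_whiskerRight, Category.assoc]

theorem trace_eq_of_unitTrace_eq {X D Y E : C} [ExactPairing X D] [ExactPairing Y E] {f : X ⟶ X}
    {g : Y ⟶ Y} (h : unitTrace X D f = unitTrace Y E g) : trace k f = trace k g :=
  smul_left_injective k (id_nonzero (𝟙_ C)) (by simp only [trace_smul_id k D, trace_smul_id k E, h])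

theorem trace_comp_comm {X Y : C} (f : X ⟶ Y) (g : Y ⟶ X) : trace k (f ≫ g) = trace k (g ≫ f) :=
  trace_eq_of_unitTrace_eq k (unitTrace_comp_comm X Y (Xᘁ) (Yᘁ) f g)

theorem trace_conj {X Y : C} (e : X ≅ Y) (f : Y ⟶ Y) : trace k (e.hom ≫ f ≫ e.inv) = trace k f := by
  rw [trace_comp_comm, Category.assoc, e.inv_hom_id, Category.comp_id]

theorem trace_eq_of_isDualHom {X D : C} [ExactPairing X D] {f : X ⟶ X} {t : D ⟶ D}
    (h : IsDualHom f t) : trace k t = trace k f :=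
  trace_eq_of_unitTrace_eq k (E := D) (unitTrace_eq_of_isDualHom (D' := Dᘁ) h)

theorem trace_tensor {Y L : C} (D : C) [ExactPairing L D] (f : Y ⊗ L ⟶ Y ⊗ L) :
    trace k f = trace k (partialTrace L D f) :=
  trace_eq_of_unitTrace_eq k (unitTrace_tensor Y L (Yᘁ) D f)

variable [MonoidalPreadditive C] [MonoidalLinear k C]

/-- The trace as a linear form. -/
def traceLinear (X : C) : (X ⟶ X) →ₗ[k] k where
  toFun f := trace k f
  map_add' f g := smul_left_injective k (id_nonzero (𝟙_ C)) (by
    simp only [add_smul, trace_smul_id k (Xᘁ), unitTrace, MonoidalPreadditive.add_whiskerRight,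
      Preadditive.comp_add, Preadditive.add_comp])
  map_smul' c f := smul_left_injective k (id_nonzero (𝟙_ C)) (by
    simp only [smul_assoc, trace_smul_id k (Xᘁ), unitTrace, MonoidalLinear.smul_whiskerRight,
      Linear.comp_smul, Linear.smul_comp, RingHom.id_apply])

theorem trace_zero (X : C) : trace k (0 : X ⟶ X) = 0 := map_zero (traceLinear k X)

theorem trace_sum {X : C} {κ : Type*} (s : Finset κ) (f : κ → (X ⟶ X)) :
    trace k (∑ i ∈ s, f i) = ∑ i ∈ s, trace k (f i) :=
  map_sum (traceLinear k X) f s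

theorem trace_smul (c : k) {X : C} (f : X ⟶ X) : trace k (c • f) = c * trace k f :=
  map_smul (traceLinear k X) c f

theorem dim_ne_zero (S : C) [Simple S] : dim k S ≠ 0 := by
  obtain ⟨r, hr⟩ := exists_retraction k (coevaluation_ne_zero S (Sᘁ) (id_nonzero S))
  obtain ⟨g, rfl⟩ := exists_eq_whiskerRight_comp_cap r
  obtain ⟨c, rfl⟩ := endomorphism_simple_eq_smul_id k g
  have h : (c * dim k S) • 𝟙 (𝟙_ C) = 𝟙 (𝟙_ C) := by
    rw [dim, ← trace_smul, trace_smul_id k (Sᘁ), unitTrace, hr]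
  intro hS
  rw [hS, mul_zero, zero_smul] at h
  exact id_nonzero _ h.symm

theorem hom_ext_of_trace_comp {A B : C} {f f' : A ⟶ B}
    (h : ∀ g : B ⟶ A, trace k (f ≫ g) = trace k (f' ≫ g)) : f = f' := by
  refine hom_ext_of_simple k fun S _ i => ?_
  by_contra hi
  obtain ⟨r, hr⟩ := exists_retraction k (sub_ne_zero.2 hi)
  apply dim_ne_zero k S
  calc
    _ = trace k (i ≫ f ≫ r) - trace k (i ≫ f' ≫ r) := by
      rw [dim, ← hr, Preadditive.sub_comp, Category.assoc, Category.assoc]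
      exact map_sub (traceLinear k S) _ _
    _ = 0 := by
      rw [trace_comp_comm, trace_comp_comm k i (f' ≫ r), Category.assoc, Category.assoc, h,
        sub_self]

theorem finrank_hom_le (A B : C) : Module.finrank k (A ⟶ B) ≤ Module.finrank k (B ⟶ A) := by
  rw [← Subspace.dual_finrank_eq (V := B ⟶ A)]
  refine LinearMap.finrank_le_finrank_of_injective
    (f := (Linear.comp A B A).compr₂ (traceLinear k A)) fun f f' h => ?_
  exact hom_ext_of_trace_comp k fun g => LinearMap.congr_fun h g

theorem finrank_hom_comm (A B : C) : Module.finrank k (A ⟶ B) = Module.finrank k (B ⟶ A) :=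
  (finrank_hom_le k A B).antisymm (finrank_hom_le k B A)

theorem eq_trace_div_dim_smul_id {S : C} [Simple S] (f : S ⟶ S) :
    f = (trace k f / dim k S) • 𝟙 S := by
  obtain ⟨c, rfl⟩ := endomorphism_simple_eq_smul_id k f
  rw [trace_smul, ← dim, mul_div_cancel_right₀ _ (dim_ne_zero k S)]

theorem bendUp_comp_bendDown_eq_smul_id (M D : C) [ExactPairing M D] {J L : C} [Simple J]
    (p : D ⊗ J ⟶ L) (q : L ⟶ D ⊗ J) :
    bendUp M D p ≫ bendDown M D q = (trace k (q ≫ p) / dim k J) • 𝟙 J := by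
  rw [eq_trace_div_dim_smul_id k (_ ≫ _),
    trace_eq_of_unitTrace_eq k (unitTrace_bendUp_comp_bendDown M D J (Jᘁ) L (Lᘁ) p q)]

theorem dim_tensor (Y L : C) : dim k (Y ⊗ L) = dim k Y * dim k L := by
  have h : partialTrace L (Lᘁ) (𝟙 (Y ⊗ L)) = dim k L • 𝟙 Y := by
    have hL := trace_smul_id k (Lᘁ) (𝟙 L)
    rw [← dim, unitTrace, id_whiskerRight, Category.id_comp] at hL
    calc
      _ = 𝟙 _ ⊗≫ Y ◁ (η_ L (Lᘁ) ≫ cap L (Lᘁ)) ⊗≫ 𝟙 _ := by rw [partialTrace]; monoidal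
      _ = _ := by
        rw [← hL, MonoidalLinear.whiskerLeft_smul]
        simp [monoidalComp]
  rw [dim, trace_tensor k (Lᘁ), h, trace_smul, ← dim, mul_comm]

end Trace

section Linking

variable (k : Type w) [Field k] [IsAlgClosed k] {C : Type u} [Category.{v} C] [Abelian C]
  [Linear k C] [MonoidalCategory C] [IsFusion k C]
  [BraidedCategory C] [RightRigidCategory C] [RibbonCategory C]

/-- The invariant of the Hopf link with components coloured by `Y` and `L`. -/
def linking (Y L : C) : k := trace k (doubleBraiding Y L)

theorem linking_comm (Y L : C) : linking k Y L = linking k L Y := trace_comp_comm k _ _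

theorem linking_dual (Y L Y' L' : C) [ExactPairing Y Y'] [ExactPairing L L'] :
    linking k Y' L' = linking k Y L :=
  (trace_eq_of_isDualHom k (isDualHom_doubleBraiding L Y L' Y')).trans (linking_comm k L Y)

theorem linking_mul_linking [MonoidalPreadditive C] [MonoidalLinear k C] (Y M L : C) [Simple Y] :
    linking k Y M * linking k Y L = dim k Y * linking k Y (M ⊗ L) := by
  have h : linking k Y (M ⊗ L) = linking k Y L / dim k Y * linking k Y M := by
    calc
      _ = trace k ((α_ Y M L).hom ≫ doubleBraiding Y (M ⊗ L) ≫ (α_ Y M L).inv) :=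
        (trace_conj k _ _).symm
      _ = trace k (partialTrace L (Lᘁ) (doubleBraiding Y L) ▷ M ≫ doubleBraiding Y M) := by
        rw [trace_tensor k (Lᘁ), partialTrace_doubleBraiding_tensor]
      _ = _ := by
        rw [eq_trace_div_dim_smul_id k (partialTrace L (Lᘁ) _), ← trace_tensor,
          MonoidalLinear.smul_whiskerRight, id_whiskerRight, Linear.smul_comp, Category.id_comp,
          trace_smul, linking, linking]
  rw [h, ← mul_assoc, mul_div_cancel₀ _ (dim_ne_zero k Y), mul_comm]

end Linking

section Decomposition

variable {C : Type u} [Category.{v} C] [Abelian C] {ι : Type*} (X : SimpleReps C ι)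

attribute [instance] SimpleReps.simple

theorem SimpleReps.hom_eq_zero {i j : ι} (h : i ≠ j) (f : X.obj i ⟶ X.obj j) : f = 0 := by
  by_contra hf
  have := isIso_of_hom_simple hf
  exact h (X.eq_of_iso i j ⟨asIso f⟩)

theorem SimpleReps.hom_ext (k : Type w) [Field k] [Linear k C] [MonoidalCategory C] [IsFusion k C]
    {Z W : C} {f g : Z ⟶ W} (h : ∀ (j) (i : X.obj j ⟶ Z), i ≫ f = i ≫ g) : f = g := by
  refine hom_ext_of_simple k fun S hS i => ?_
  obtain ⟨j, ⟨e⟩⟩ := X.exists_iso S hS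
  rw [← cancel_epi e.inv, ← Category.assoc, h j, Category.assoc]

/-- A decomposition of `Z` into simple objects, grouped into isotypic components; `index j` is the
set of summands `X_j`. -/
structure Decomposition (Z : C) [Fintype ι] where
  /-- the set of copies of `X_j` -/
  index : ι → Type
  [fintype : ∀ j, Fintype (index j)]
  [decidableEq : ∀ j, DecidableEq (index j)]
  /-- the inclusions -/
  incl : ∀ j, index j → (X.obj j ⟶ Z)
  /-- the projections -/
  proj : ∀ j, index j → (Z ⟶ X.obj j)
  incl_proj : ∀ j a b, incl j a ≫ proj j b = if a = b then 𝟙 _ else 0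
  total : ∑ j, ∑ a, proj j a ≫ incl j a = 𝟙 Z

attribute [instance] Decomposition.fintype Decomposition.decidableEq

theorem linearIndependent_of_comp_eq (k : Type w) [Field k] [Linear k C] {S Z : C} (hS : 𝟙 S ≠ 0)
    {κ : Type*} [DecidableEq κ] {incl : κ → (S ⟶ Z)} {proj : κ → (Z ⟶ S)}
    (h : ∀ a b, incl a ≫ proj b = if a = b then 𝟙 S else 0) : LinearIndependent k incl := by
  rw [linearIndependent_iff']
  intro s c hc b hbs
  have comp_proj := congrArg (· ≫ proj b) hc
  simp only [Preadditive.sum_comp, Linear.smul_comp, h, zero_comp, smul_ite, smul_zero,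
    Finset.sum_ite_eq', if_pos hbs] at comp_proj
  exact (smul_eq_zero.1 comp_proj).resolve_right hS

variable {X} [Fintype ι] {Z : C}

theorem Decomposition.hom_eq_sum (P : Decomposition X Z) {j : ι} (f : X.obj j ⟶ Z) :
    f = ∑ a, (f ≫ P.proj j a) ≫ P.incl j a := by
  conv_lhs => rw [← Category.comp_id f, ← P.total, Preadditive.comp_sum]
  rw [Finset.sum_eq_single j]
  · simp only [Preadditive.comp_sum, Category.assoc]
  · intro j' _ hj
    simp only [Preadditive.comp_sum, ← Category.assoc, X.hom_eq_zero hj.symm (_ ≫ _), zero_comp,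
      Finset.sum_const_zero]
  · simp

theorem incl_comp_sum_proj_comp_incl {index : ι → Type*} [∀ j, Fintype (index j)]
    [∀ j, DecidableEq (index j)] {incl : ∀ j, index j → (X.obj j ⟶ Z)}
    {proj : ∀ j, index j → (Z ⟶ X.obj j)}
    (incl_proj : ∀ j a b, incl j a ≫ proj j b = if a = b then 𝟙 _ else 0) (j : ι) (a : index j) :
    incl j a ≫ (∑ j, ∑ a, proj j a ≫ incl j a) = incl j a := by
  rw [Preadditive.comp_sum, Finset.sum_eq_single j]
  · simp only [Preadditive.comp_sum, ← Category.assoc (incl j a), incl_proj, ite_comp,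
      Category.id_comp, zero_comp, Finset.sum_ite_eq, Finset.mem_univ, if_true]
  · intro j' _ hj
    simp only [Preadditive.comp_sum, ← Category.assoc, X.hom_eq_zero hj.symm (_ ≫ _), zero_comp,
      Finset.sum_const_zero]
  · simp

theorem Decomposition.doubleBraiding_eq_sum [MonoidalCategory C] [MonoidalPreadditive C]
    [BraidedCategory C] (P : Decomposition X Z) (Y : C) :
    doubleBraiding Y Z =
      ∑ j, ∑ a, Y ◁ P.proj j a ≫ doubleBraiding Y (X.obj j) ≫ Y ◁ P.incl j a := by
  simp only [← doubleBraiding_naturality_right, ← whiskerLeft_comp_assoc]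
  simp only [← Preadditive.sum_comp, ← whiskerLeft_sum, P.total, whiskerLeft_id, Category.id_comp]

variable (X Z) in
theorem nonempty_decomposition (k : Type w) [Field k] [Linear k C] [MonoidalCategory C]
    [IsFusion k C] : Nonempty (Decomposition X Z) := by
  classical
  obtain ⟨n, S, b, hS, ⟨hb⟩, ⟨e⟩⟩ := IsFusion.semisimple k Z
  choose i φ using fun a => X.exists_iso (S a) (hS a)
  replace φ := fun a => (φ a).some
  refine ⟨{ index := fun j => {a : Fin n // i a = j}
            incl := fun j a => eqToHom (by rw [a.2]) ≫ (φ a.1).inv ≫ b.ι a.1 ≫ e.inv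
            proj := fun j a => e.hom ≫ b.π a.1 ≫ (φ a.1).hom ≫ eqToHom (by rw [a.2])
            incl_proj := ?_
            total := ?_ }⟩
  · rintro j ⟨a, rfl⟩ ⟨a', h'⟩
    by_cases h : a = a'
    · subst h; simp
    · simp [h, reassoc_of% bicone_ι_π_ne b h]
  · calc
      _ = ∑ a : Fin n, e.hom ≫ (b.π a ≫ b.ι a) ≫ e.inv := by
        rw [← Fintype.sum_sigma']
        refine Fintype.sum_equiv (Equiv.sigmaFiberEquiv i) _ _ ?_
        rintro ⟨j, a, rfl⟩
        simp [Equiv.sigmaFiberEquiv]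
      _ = e.hom ≫ (∑ a, b.π a ≫ b.ι a) ≫ e.inv := by
        rw [Preadditive.sum_comp, Preadditive.comp_sum]
      _ = _ := by rw [IsBilimit.total hb, Category.id_comp, e.hom_inv_id]

variable (k : Type w) [Field k] [IsAlgClosed k] [Linear k C] [MonoidalCategory C] [IsFusion k C]

theorem Decomposition.card_index (P : Decomposition X Z) (j : ι) :
    Fintype.card (P.index j) = Module.finrank k (X.obj j ⟶ Z) := by
  have li : LinearIndependent k (P.incl j) :=
    linearIndependent_of_comp_eq k (id_nonzero _) (P.incl_proj j)
  refine (Module.finrank_eq_card_basis (Module.Basis.mk li fun f _ => ?_)).symm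
  rw [P.hom_eq_sum f]
  refine Submodule.sum_mem _ fun a _ => ?_
  obtain ⟨c, hc⟩ := endomorphism_simple_eq_smul_id k (f ≫ P.proj j a)
  rw [← hc, Linear.smul_comp, Category.id_comp]
  exact Submodule.smul_mem _ _ (Submodule.subset_span ⟨a, rfl⟩)

/-- Orthonormal inclusions and projections decompose `Z` as soon as there are enough of them. -/
def Decomposition.ofCardEq (index : ι → Type) [∀ j, Fintype (index j)]
    [∀ j, DecidableEq (index j)] (incl : ∀ j, index j → (X.obj j ⟶ Z))
    (proj : ∀ j, index j → (Z ⟶ X.obj j))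
    (incl_proj : ∀ j a b, incl j a ≫ proj j b = if a = b then 𝟙 _ else 0)
    (card_index : ∀ j, Fintype.card (index j) = Module.finrank k (X.obj j ⟶ Z)) :
    Decomposition X Z where
  index := index
  incl := incl
  proj := proj
  incl_proj := incl_proj
  total := by
    refine X.hom_ext k fun j f => ?_
    have span_incl : f ∈ Submodule.span k (Set.range (incl j)) := by
      rw [(linearIndependent_of_comp_eq k (id_nonzero _)
        (incl_proj j)).span_eq_top_of_card_eq_finrank' (card_index j)]
      trivial
    induction span_incl using Submodule.span_induction with
    | mem f hf =>
      obtain ⟨a, rfl⟩ := hf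
      rw [incl_comp_sum_proj_comp_incl incl_proj, Category.comp_id]
    | zero => rw [zero_comp, zero_comp]
    | add f g _ _ hf hg => rw [Preadditive.add_comp, Preadditive.add_comp, hf, hg]
    | smul c f _ hf => rw [Linear.smul_comp, Linear.smul_comp, hf]

end Decomposition

section HandleSlide

variable (k : Type w) [Field k] [IsAlgClosed k] {C : Type u} [Category.{v} C] [Abelian C]
  [Linear k C] [MonoidalCategory C] [IsFusion k C]
  [BraidedCategory C] [RightRigidCategory C] [RibbonCategory C]
  [MonoidalPreadditive C] [MonoidalLinear k C]
  {ι : Type*} [Fintype ι] {X : SimpleReps C ι}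

variable (X) in
theorem linking_eq_sum (Y Z : C) :
    linking k Y Z = ∑ j, (Module.finrank k (X.obj j ⟶ Z) : k) * linking k Y (X.obj j) := by
  obtain ⟨P⟩ := nonempty_decomposition X Z k
  simp only [linking, P.doubleBraiding_eq_sum Y, trace_sum]
  refine Finset.sum_congr rfl fun j _ => ?_
  rw [← P.card_index k, ← nsmul_eq_mul, ← Finset.card_univ, ← Finset.sum_const]
  refine Finset.sum_congr rfl fun a _ => ?_
  rw [trace_comp_comm, Category.assoc, ← MonoidalCategory.whiskerLeft_comp, P.incl_proj,
    if_pos rfl, whiskerLeft_id, Category.comp_id]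

/-- Decompositions of all the `M* ⊗ X_j` give decompositions of all the `M ⊗ X_l`, by bending the
strand `M`. -/
def Decomposition.rotate {M : C} (P : ∀ j, Decomposition X ((Mᘁ : C) ⊗ X.obj j)) (l : ι) :
    Decomposition X (M ⊗ X.obj l) :=
  Decomposition.ofCardEq k (fun j => (P j).index l)
    (fun j a => bendUp M (Mᘁ) ((P j).proj l a))
    (fun j a => (dim k (X.obj j) / dim k (X.obj l)) • bendDown M (Mᘁ) ((P j).incl l a))
    (fun j a b => by
      have hj := dim_ne_zero k (X.obj j)
      have hl := dim_ne_zero k (X.obj l)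
      rw [Linear.comp_smul, bendUp_comp_bendDown_eq_smul_id k, (P j).incl_proj]
      by_cases hab : a = b
      · rw [if_pos hab, if_pos hab.symm, ← dim, smul_smul, div_mul_div_cancel₀' hj,
          div_self hl, one_smul]
      · rw [if_neg hab, if_neg (Ne.symm hab), trace_zero, zero_div, zero_smul, smul_zero])
    (fun j => by
      rw [(P j).card_index k, finrank_hom_comm, finrank_tensor_left_hom k _ M])

theorem sum_bendUp_comp_bendDown {M J : C} (P : Decomposition X ((Mᘁ : C) ⊗ J)) {Y : C}
    (g : Y ⊗ M ⟶ Y ⊗ M) :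
    ∑ l, ∑ a, Y ◁ bendUp M (Mᘁ) (P.proj l a) ≫ (α_ Y M (X.obj l)).inv ≫ g ▷ X.obj l ≫
        (α_ Y M (X.obj l)).hom ≫ Y ◁ bendDown M (Mᘁ) (P.incl l a) =
      partialTrace M (Mᘁ) g ▷ J := by
  simp only [bendUp_comp_bendDown]
  rw [partialTrace_whiskerRight_eq, ← P.total]
  simp only [monoidalComp, whiskerLeft_sum, Preadditive.comp_sum, Preadditive.sum_comp]

theorem Decomposition.trace_whiskerRight_comp_doubleBraiding {M L : C}
    (P : Decomposition X (M ⊗ L)) {Y : C} (g : Y ⊗ M ⟶ Y ⊗ M) :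
    trace k (g ▷ L ≫ (α_ Y M L).hom ≫ doubleBraiding Y (M ⊗ L) ≫ (α_ Y M L).inv) =
      ∑ j, ∑ a, trace k ((Y ◁ P.incl j a ≫ (α_ Y M L).inv ≫ g ▷ L ≫ (α_ Y M L).hom ≫
        Y ◁ P.proj j a) ≫ doubleBraiding Y (X.obj j)) := by
  simp only [P.doubleBraiding_eq_sum Y, Preadditive.sum_comp, Preadditive.comp_sum, trace_sum,
    Category.assoc]
  refine Finset.sum_congr rfl fun j _ => Finset.sum_congr rfl fun a _ => ?_
  have h := trace_comp_comm k (g ▷ L ≫ (α_ Y M L).hom ≫ Y ◁ P.proj j a ≫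
    doubleBraiding Y (X.obj j)) (Y ◁ P.incl j a ≫ (α_ Y M L).inv)
  simpa only [Category.assoc] using h

variable (X)

/-- The handle slide of a strand `M` over the loop coloured by `∑ d_l X_l`. -/
theorem sum_dim_mul_trace_whiskerRight (Y M : C) (g : Y ⊗ M ⟶ Y ⊗ M) :
    ∑ l, dim k (X.obj l) * trace k (g ▷ X.obj l ≫ (α_ Y M (X.obj l)).hom ≫
        doubleBraiding Y (M ⊗ X.obj l) ≫ (α_ Y M (X.obj l)).inv) =
      ∑ j, dim k (X.obj j) *
        trace k (partialTrace M (Mᘁ) g ▷ X.obj j ≫ doubleBraiding Y (X.obj j)) := by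
  have P := fun j => (nonempty_decomposition X ((Mᘁ : C) ⊗ X.obj j) k).some
  simp only [(Decomposition.rotate k P _).trace_whiskerRight_comp_doubleBraiding k]
  simp only [← sum_bendUp_comp_bendDown (P _), Preadditive.sum_comp, trace_sum, Finset.mul_sum]
  rw [Finset.sum_comm]
  refine Finset.sum_congr rfl fun j _ => Finset.sum_congr rfl fun l _ =>
    Finset.sum_congr rfl fun a _ => ?_
  simp only [Decomposition.rotate, Decomposition.ofCardEq, MonoidalLinear.whiskerLeft_smul,
    Linear.comp_smul, Linear.smul_comp, trace_smul]
  rw [← mul_assoc, mul_div_cancel₀ _ (dim_ne_zero k (X.obj l))]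

/-- The operator on `Y` given by a loop around it coloured by `∑ d_l X_l`. -/
def encircle (Y : C) : Y ⟶ Y :=
  ∑ l, dim k (X.obj l) • partialTrace (X.obj l) ((X.obj l)ᘁ) (doubleBraiding Y (X.obj l))

theorem trace_comp_encircle (Y : C) (f : Y ⟶ Y) :
    trace k (f ≫ encircle k X Y) =
      ∑ l, dim k (X.obj l) * trace k (f ▷ X.obj l ≫ doubleBraiding Y (X.obj l)) := by
  simp only [encircle, Preadditive.comp_sum, Linear.comp_smul, trace_sum, trace_smul]
  refine Finset.sum_congr rfl fun l _ => ?_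
  rw [trace_tensor k ((X.obj l)ᘁ) (_ ▷ _ ≫ _), partialTrace_whiskerRight_comp]

theorem trace_encircle (Y : C) :
    trace k (encircle k X Y) = ∑ l, dim k (X.obj l) * linking k Y (X.obj l) := by
  simpa only [id_whiskerRight, Category.id_comp, linking] using
    trace_comp_encircle k X Y (𝟙 Y)

theorem encircle_whiskerRight_comp_doubleBraiding (Y M : C) :
    encircle k X Y ▷ M ≫ doubleBraiding Y M = encircle k X Y ▷ M := by
  refine hom_ext_of_trace_comp k fun g => ?_
  rw [trace_comp_comm, trace_comp_comm k _ g]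
  calc
    _ = ∑ l, dim k (X.obj l) * trace k (g ▷ X.obj l ≫ (α_ Y M (X.obj l)).hom ≫
          doubleBraiding Y (M ⊗ X.obj l) ≫ (α_ Y M (X.obj l)).inv) := by
      simp only [encircle, sum_whiskerRight, MonoidalLinear.smul_whiskerRight,
        Preadditive.comp_sum, Preadditive.sum_comp, Linear.comp_smul, Linear.smul_comp, trace_sum,
        trace_smul]
      refine Finset.sum_congr rfl fun l _ => ?_
      rw [trace_tensor k ((X.obj l)ᘁ) (_ ▷ _ ≫ _), partialTrace_whiskerRight_comp,
        partialTrace_doubleBraiding_tensor]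
    _ = trace k (partialTrace M (Mᘁ) g ≫ encircle k X Y) := by
      rw [sum_dim_mul_trace_whiskerRight, trace_comp_encircle]
    _ = trace k (g ≫ encircle k X Y ▷ M) := by
      rw [trace_tensor k (Mᘁ), partialTrace_comp_whiskerRight]

open Classical in
theorem sum_dim_mul_linking (Y : C) [Simple Y] :
    ∑ l, dim k (X.obj l) * linking k Y (X.obj l) =
      if IsTransparent Y then globalDim k X * dim k Y else 0 := by
  split_ifs with h
  · have (l : ι) : linking k Y (X.obj l) = dim k (Y ⊗ X.obj l) := congrArg (trace k) (h _)
    simp only [this, globalDim, dim_tensor, Finset.sum_mul]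
    exact Finset.sum_congr rfl fun l _ => by ring
  · rw [← trace_encircle]
    by_contra h0
    refine h fun M => ?_
    have hM := encircle_whiskerRight_comp_doubleBraiding k X Y M
    rw [eq_trace_div_dim_smul_id k (encircle k X Y), MonoidalLinear.smul_whiskerRight,
      id_whiskerRight, Linear.smul_comp, Category.id_comp] at hM
    exact smul_right_injective _ (div_ne_zero h0 (dim_ne_zero k Y)) hM

end HandleSlide

section Multiplicativity

variable (k : Type w) [Field k] [IsAlgClosed k] {C : Type u} [Category.{v} C] [Abelian C]
  [Linear k C] [MonoidalCategory C] [IsFusion k C]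
  [BraidedCategory C] [RightRigidCategory C] [RibbonCategory C]
  [MonoidalPreadditive C] [MonoidalLinear k C]
  {ι : Type*} [Fintype ι] (X : SimpleReps C ι)

theorem linking_rightDual_mul_linking (Y M L : C) [Simple Y] :
    linking k (Yᘁ) M * linking k Y L = dim k Y * linking k (Yᘁ) (M ⊗ Lᘁ) := by
  let _ : ExactPairing (Mᘁ) M := exactPairing_swap M (Mᘁ)
  rw [linking_dual k Y (Mᘁ) (Yᘁ) M, linking_dual k Y (L ⊗ Mᘁ) (Yᘁ) (M ⊗ Lᘁ), mul_comm,
    linking_mul_linking]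

open Classical in
theorem sum_linking_mul_linking (Y Z : C) :
    ∑ l, linking k Y (X.obj l) * linking k Z (X.obj l) =
      globalDim k X * ∑ c with IsTransparent (X.obj c),
        dim k (X.obj c) * (Module.finrank k (X.obj c ⟶ Y ⊗ Z) : k) := by
  calc
    _ = ∑ l, dim k (X.obj l) * ∑ c, (Module.finrank k (X.obj c ⟶ Y ⊗ Z) : k) *
          linking k (X.obj c) (X.obj l) := by
      refine Finset.sum_congr rfl fun l _ => ?_
      simp only [linking_comm k _ (X.obj l)]
      rw [linking_mul_linking, linking_eq_sum k X (X.obj l)]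
    _ = ∑ c, (Module.finrank k (X.obj c ⟶ Y ⊗ Z) : k) *
          ∑ l, dim k (X.obj l) * linking k (X.obj c) (X.obj l) := by
      simp only [Finset.mul_sum, mul_left_comm (dim k _)]
      exact Finset.sum_comm
    _ = _ := by
      simp only [sum_dim_mul_linking, Finset.sum_filter, Finset.mul_sum, mul_ite, mul_zero]
      exact Finset.sum_congr rfl fun c _ => by congr 1; ring

end Multiplicativity

section Fusion

variable (k : Type w) [Field k] {C : Type u} [Category.{v} C] [Abelian C]
  [Linear k C] [MonoidalCategory C] {ι : Type*} (X : SimpleReps C ι)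

theorem fusionCoeff_comm [BraidedCategory C] (i j l : ι) :
    fusionCoeff k X i j l = fusionCoeff k X j i l :=
  LinearEquiv.finrank_eq (Linear.homCongr k (Iso.refl _) (β_ _ _))

theorem fusionCoeff_eq_finrank [IsAlgClosed k] [IsFusion k C] [BraidedCategory C]
    [RightRigidCategory C] [RibbonCategory C] [MonoidalPreadditive C] [MonoidalLinear k C]
    (i j l : ι) :
    fusionCoeff k X i j l = Module.finrank k (X.obj i ⟶ X.obj l ⊗ (X.obj j)ᘁ) := by
  rw [fusionCoeff, finrank_hom_comm, finrank_tensor_right_hom k _ _ ((X.obj j)ᘁ)]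

variable [Fintype ι]

theorem fusion_apply (x y : Verlinde k ι) (m : ι) :
    fusion k X x y m = ∑ j, ∑ l, x j * y l * (fusionCoeff k X j l m : k) := by
  classical
  simp [fusion, basisVec, Finsupp.linearCombination_apply, Finsupp.sum_fintype,
    Finsupp.single_apply, Finset.mul_sum, mul_assoc]

theorem fusion_comm [BraidedCategory C] (x y : Verlinde k ι) : fusion k X x y = fusion k X y x := by
  ext m
  rw [fusion_apply, fusion_apply, Finset.sum_comm]
  simp only [fusionCoeff_comm k X _ _ m, mul_comm]

end Fusion

section Coordinates

variable (k : Type w) [Field k] [IsAlgClosed k] {C : Type u} [Category.{v} C] [Abelian C]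
  [Linear k C] [MonoidalCategory C] [IsFusion k C]
  [BraidedCategory C] [RightRigidCategory C] [RibbonCategory C]
  {ι : Type*} (X : SimpleReps C ι)

theorem conv_apply (x y : Verlinde k ι) (i : ι) :
    conv k X x y i = x i * y i / dim k (X.obj i) := by
  classical
  induction x using Finsupp.induction_linear with
  | zero => simp
  | add x x' hx hx' => simp only [map_add, LinearMap.add_apply, Finsupp.add_apply, hx, hx', add_mul,
      add_div]
  | single a c =>
    induction y using Finsupp.induction_linear with
    | zero => simp
    | add y y' hy hy' => simp only [map_add, Finsupp.add_apply, hy, hy', mul_add, add_div]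
    | single b d =>
      rcases eq_or_ne a b with rfl | hab <;> rcases eq_or_ne a i with rfl | hai <;>
        simp_all [conv, basisVec, div_eq_mul_inv, mul_assoc]

theorem conv_comm (x y : Verlinde k ι) : conv k X x y = conv k X y x := by
  ext i
  rw [conv_apply, conv_apply, mul_comm (x i)]

variable [Fintype ι]

theorem sMap_apply (x : Verlinde k ι) (j : ι) : sMap k X x j = ∑ i, x i * sMatrix k X i j := by
  classical
  simp [sMap, basisVec, Finsupp.linearCombination_apply, Finsupp.sum_fintype, Finsupp.single_apply]

open Classical in
theorem phiJ_apply (c : ι) :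
    phiJ k X c = if IsTransparent (X.obj c) then dim k (X.obj c) else 0 := by
  simp [phiJ, basisVec, Finsupp.finsetSum_apply, Finsupp.single_apply]

variable [MonoidalPreadditive C] [MonoidalLinear k C]

theorem fusion_globalDim_smul_phiJ_apply (y : Verlinde k ι) (a : ι) :
    fusion k X (globalDim k X • phiJ k X) y a =
      ∑ l, linking k (X.obj a) (X.obj l) * sMap k X y l := by
  classical
  calc
    _ = ∑ b, y b * (globalDim k X * ∑ c with IsTransparent (X.obj c),
          dim k (X.obj c) * (fusionCoeff k X c b a : k)) := by
      simp only [fusion_apply, Finsupp.smul_apply, smul_eq_mul, phiJ_apply, Finset.sum_filter,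
        Finset.mul_sum]
      rw [Finset.sum_comm]
      refine Finset.sum_congr rfl fun b _ => Finset.sum_congr rfl fun c _ => ?_
      split_ifs <;> ring
    _ = ∑ b, y b * ∑ l, linking k (X.obj a) (X.obj l) * sMatrix k X b l := by
      simp only [fusionCoeff_eq_finrank, ← sum_linking_mul_linking]
      rfl
    _ = _ := by
      simp only [sMap_apply, Finset.mul_sum, mul_left_comm (y _)]
      exact Finset.sum_comm

theorem sum_sMatrix_mul_fusionCoeff (a l m : ι) :
    ∑ j, sMatrix k X a j * (fusionCoeff k X j l m : k) =
      linking k (X.obj a) (X.obj l) / dim k (X.obj a) * sMatrix k X a m := by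
  have h := linking_rightDual_mul_linking k (X.obj a) (X.obj m) (X.obj l)
  rw [linking_eq_sum k X _ (_ ⊗ _)] at h
  simp only [← fusionCoeff_eq_finrank] at h
  rw [div_mul_eq_mul_div, eq_div_iff (dim_ne_zero k (X.obj a)), mul_comm,
    mul_comm (linking _ _ _)]
  exact (h.trans (congrArg _ (Finset.sum_congr rfl fun j _ => mul_comm _ _))).symm

theorem fusion_sMap_apply (x z : Verlinde k ι) (m : ι) :
    fusion k X (sMap k X x) z m =
      ∑ a, x a * (∑ l, linking k (X.obj a) (X.obj l) * z l) / dim k (X.obj a) *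
        sMatrix k X a m := by
  calc
    _ = ∑ a, ∑ l, x a * z l * ∑ j, sMatrix k X a j * (fusionCoeff k X j l m : k) := by
      simp only [fusion_apply, sMap_apply, Finset.sum_mul, Finset.mul_sum]
      rw [Finset.sum_comm]
      refine (Finset.sum_congr rfl fun l _ => Finset.sum_comm).trans (Finset.sum_comm.trans ?_)
      exact Finset.sum_congr rfl fun a _ => Finset.sum_congr rfl fun l _ =>
        Finset.sum_congr rfl fun j _ => by ring
    _ = _ := by
      simp only [sum_sMatrix_mul_fusionCoeff, Finset.mul_sum, Finset.sum_mul, Finset.sum_div]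
      exact Finset.sum_congr rfl fun a _ => Finset.sum_congr rfl fun l _ => by ring

theorem sMap_conv_fusion_right (x y : Verlinde k ι) :
    sMap k X (conv k X x (fusion k X (globalDim k X • phiJ k X) y)) =
      fusion k X (sMap k X x) (sMap k X y) := by
  ext m
  simp only [sMap_apply k X (conv k X _ _), conv_apply, fusion_globalDim_smul_phiJ_apply,
    fusion_sMap_apply]

theorem sMap_conv_fusion_left (x y : Verlinde k ι) :
    sMap k X (conv k X (fusion k X (globalDim k X • phiJ k X) x) y) =
      fusion k X (sMap k X x) (sMap k X y) := by
  rw [conv_comm, sMap_conv_fusion_right, fusion_comm]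

end Coordinates

section Reverse

variable {C : Type u} [Category.{v} C] [MonoidalCategory C] [BraidedCategory C]

theorem isTransparent_reverse (Y : C) :
    @IsTransparent C _ _ (reverseBraiding C) Y ↔ IsTransparent Y := by
  refine forall_congr' fun Z => ?_
  change (β_ Z Y).inv ≫ (β_ Y Z).inv = _ ↔ _
  rw [Iso.inv_comp_eq, Category.comp_id, eq_comm, Iso.hom_comp_eq_id]

variable [RightRigidCategory C] [RibbonCategory C]

theorem twist_unit : (RibbonCategory.twist (𝟙_ C)).hom = 𝟙 _ := by
  have hn := RibbonCategory.twist_naturality (λ_ (𝟙_ C)).hom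
  have hb : (β_ (𝟙_ C) (𝟙_ C)).hom = 𝟙 _ := by
    rw [braiding_tensorUnit_right]; monoidal
  rw [RibbonCategory.twist_tensor, hb, Category.comp_id, Category.comp_id,
    MonoidalCategory.tensorHom_def, Category.assoc, leftUnitor_naturality, unitors_equal,
    rightUnitor_naturality_assoc, cancel_epi] at hn
  rwa [eq_comm, ← cancel_epi (RibbonCategory.twist (𝟙_ C)).hom, Category.comp_id]

theorem braiding_inv_comp_evaluation (X D : C) [ExactPairing X D] :
    (β_ D X).inv ≫ ε_ X D = (RibbonCategory.twist X).hom ▷ D ≫ cap X D := by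
  have hX : (RibbonCategory.twist D).hom ▷ X ≫ ε_ X D = D ◁ (RibbonCategory.twist X).hom ≫ ε_ X D :=
    isDualHom_twist X D
  rw [Iso.inv_comp_eq]
  calc
    ε_ X D = (RibbonCategory.twist (D ⊗ X)).hom ≫ ε_ X D := by
      rw [← RibbonCategory.twist_naturality, twist_unit, Category.comp_id]
    _ = doubleBraiding D X ≫ D ◁ (RibbonCategory.twist X).hom ≫
          D ◁ (RibbonCategory.twist X).hom ≫ ε_ X D := by
      rw [RibbonCategory.twist_tensor, MonoidalCategory.tensorHom_def', ← hX]
      simp [doubleBraiding]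
    _ = (β_ D X).hom ≫ (RibbonCategory.twist X).hom ▷ D ≫ cap X D := by
      simp [doubleBraiding, cap]

theorem twist_inv_naturality {X Y : C} (f : X ⟶ Y) :
    f ≫ (RibbonCategory.twist Y).inv = (RibbonCategory.twist X).inv ≫ f := by
  rw [Iso.comp_inv_eq, Category.assoc, RibbonCategory.twist_naturality, Iso.inv_hom_id_assoc]

theorem twist_inv_tensor (X Y : C) :
    (RibbonCategory.twist (X ⊗ Y)).inv =
      ((RibbonCategory.twist X).inv ⊗ₘ (RibbonCategory.twist Y).inv) ≫
        (β_ Y X).inv ≫ (β_ X Y).inv := by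
  rw [← cancel_epi (RibbonCategory.twist (X ⊗ Y)).hom, Iso.hom_inv_id, RibbonCategory.twist_tensor]
  simp

theorem twist_inv_dual (X : C) :
    (RibbonCategory.twist (Xᘁ)).inv = (RibbonCategory.twist X).invᘁ := by
  rw [← cancel_epi (RibbonCategory.twist (Xᘁ)).hom, Iso.hom_inv_id,
    RibbonCategory.twist_dual, ← comp_rightAdjointMate, Iso.inv_hom_id, rightAdjointMate_id]

/-- The ribbon structure of the reversed braiding, given by the inverse twists. -/
@[reducible]
def reverseRibbon : @RibbonCategory C _ _ (reverseBraiding C) _ :=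
  @RibbonCategory.mk C _ _ (reverseBraiding C) _ (fun X => (RibbonCategory.twist X).symm)
    twist_inv_naturality twist_inv_tensor twist_inv_dual

theorem cap_reverse (X D : C) [ExactPairing X D] :
    @cap C _ _ (reverseBraiding C) _ reverseRibbon X D _ = cap X D := by
  change (RibbonCategory.twist X).inv ▷ D ≫ (β_ D X).inv ≫ ε_ X D = _
  rw [braiding_inv_comp_evaluation, ← comp_whiskerRight_assoc, Iso.inv_hom_id, id_whiskerRight,
    Category.id_comp]

theorem unitTrace_reverse (X D : C) [ExactPairing X D] (f : X ⟶ X) :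
    @unitTrace C _ _ (reverseBraiding C) _ reverseRibbon X D _ f = unitTrace X D f :=
  congrArg (fun c => η_ X D ≫ f ▷ D ≫ c) (cap_reverse X D)

end Reverse

section ReverseVerlinde

variable (k : Type w) [Field k] [IsAlgClosed k] {C : Type u} [Category.{v} C] [Abelian C]
  [Linear k C] [MonoidalCategory C] [IsFusion k C]
  [BraidedCategory C] [RightRigidCategory C] [RibbonCategory C]

theorem trace_reverse {Y : C} (f : Y ⟶ Y) :
    @trace k _ _ C _ _ _ _ _ (reverseBraiding C) _ reverseRibbon Y f = trace k f := by
  refine smul_left_injective k (id_nonzero (𝟙_ C)) ?_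
  have h := @trace_smul_id k _ _ C _ _ _ _ _ (reverseBraiding C) _ reverseRibbon Y (Yᘁ) _ f
  exact h.trans ((unitTrace_reverse Y (Yᘁ) f).trans (trace_smul_id k (Yᘁ) f).symm)

theorem dim_reverse (Y : C) :
    @dim k _ _ C _ _ _ _ _ (reverseBraiding C) _ reverseRibbon Y = dim k Y := trace_reverse k _

variable {ι : Type*} (X : SimpleReps C ι)

theorem conv_reverse :
    @conv k _ _ C _ _ _ _ _ (reverseBraiding C) _ reverseRibbon ι X = conv k X := by
  simp only [conv, dim_reverse]

theorem sMatrix_reverse (i j : ι) :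
    @sMatrix k _ _ C _ _ _ _ _ (reverseBraiding C) _ reverseRibbon ι X i j = sBarMatrix k X i j :=
  trace_reverse k _

variable [Fintype ι]

theorem globalDim_reverse :
    @globalDim k _ _ C _ _ _ _ _ (reverseBraiding C) _ reverseRibbon ι _ X = globalDim k X := by
  simp only [globalDim, dim_reverse]

theorem phiJ_reverse :
    @phiJ k _ _ C _ _ _ _ _ (reverseBraiding C) _ reverseRibbon ι _ X = phiJ k X := by
  classical
  simp only [phiJ, dim_reverse, isTransparent_reverse]

theorem sMap_reverse :
    @sMap k _ _ C _ _ _ _ _ (reverseBraiding C) _ reverseRibbon ι _ X = sBarMap k X := by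
  simp only [sMap, sBarMap, sMatrix_reverse]

variable [MonoidalPreadditive C] [MonoidalLinear k C]

theorem sBarMap_conv_fusion_right (x y : Verlinde k ι) :
    sBarMap k X (conv k X x (fusion k X (globalDim k X • phiJ k X) y)) =
      fusion k X (sBarMap k X x) (sBarMap k X y) := by
  simpa only [sMap_reverse, conv_reverse, phiJ_reverse, globalDim_reverse] using
    @sMap_conv_fusion_right k _ _ C _ _ _ _ _ (reverseBraiding C) _ reverseRibbon ι X _ _ _ x y

theorem sBarMap_conv_fusion_left (x y : Verlinde k ι) :
    sBarMap k X (conv k X (fusion k X (globalDim k X • phiJ k X) x) y) =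
      fusion k X (sBarMap k X x) (sBarMap k X y) := by
  rw [conv_comm, sBarMap_conv_fusion_right, fusion_comm]

end ReverseVerlinde

end Premodular

end

theorem theoremt {k : Type w} [Field k] [IsAlgClosed k]
    {C : Type u} [Category.{v} C] [Abelian C] [Linear k C]
    [MonoidalCategory C] [MonoidalPreadditive C] [MonoidalLinear k C]
    [BraidedCategory C] [RightRigidCategory C] [Premodular.RibbonCategory C]
    [Premodular.IsFusion k C]
    {ι : Type*} [Fintype ι] (X : Premodular.SimpleReps C ι)
    (x y : Premodular.Verlinde k ι) :
    (Premodular.sMap k X (Premodular.conv k X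
          (Premodular.fusion k X (Premodular.globalDim k X • Premodular.phiJ k X) x) y) =
        Premodular.sMap k X (Premodular.conv k X x
          (Premodular.fusion k X (Premodular.globalDim k X • Premodular.phiJ k X) y)) ∧
      Premodular.sMap k X (Premodular.conv k X x
          (Premodular.fusion k X (Premodular.globalDim k X • Premodular.phiJ k X) y)) =
        Premodular.fusion k X (Premodular.sMap k X x) (Premodular.sMap k X y)) ∧
    (Premodular.sBarMap k X (Premodular.conv k X
          (Premodular.fusion k X (Premodular.globalDim k X • Premodular.phiJ k X) x) y) =
        Premodular.sBarMap k X (Premodular.conv k X x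
          (Premodular.fusion k X (Premodular.globalDim k X • Premodular.phiJ k X) y)) ∧
      Premodular.sBarMap k X (Premodular.conv k X x
          (Premodular.fusion k X (Premodular.globalDim k X • Premodular.phiJ k X) y)) =
        Premodular.fusion k X (Premodular.sBarMap k X x) (Premodular.sBarMap k X y)) := by
  refine ⟨⟨?_, Premodular.sMap_conv_fusion_right k X x y⟩,
    ?_, Premodular.sBarMap_conv_fusion_right k X x y⟩
  · rw [Premodular.sMap_conv_fusion_left, Premodular.sMap_conv_fusion_right]
  · rw [Premodular.sBarMap_conv_fusion_left, Premodular.sBarMap_conv_fusion_right]
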